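/- Let $L$ be a first-order language and let $\mathfrak M$ be a nonempty $L$-structure that is $\aleph_1$-saturated (for instance, a large saturated model of a complete theory), with underlying set $M$. Let $\phi(\mathbf x,\mathbf y)$ be an $L$-formula, $\mathbf x=\langle x_1,\dots,x_l\rangle$, $\mathbf y=\langle y_1,\dots,y_k\rangle$. For $A\subseteq M^k$ let $S_\phi(A)$ be the set of $\phi$-types over $A$, each identified with the set $P\subseteq A$ of its positive parameters; that is, $P\in S_\phi(A)$ iff $\{\phi(\mathbf x,\mathbf a):\mathbf a\in P\}\cup\{\neg\phi(\mathbf x,\mathbf a):\mathbf a\in A\setminus P\}$ is finitely satisfiable in $\mathfrak M$. A family $\mathcal C\subseteq\mathcal P(X)$ is $d$-maximum on $X$ ($d\in\mathbb N$) if $|\{C\cap F:C\in\mathcal C\}|=\sum_{i=0}^{d}\binom{|F|}{i}$ for every finite $F\subseteq X$. The VC-maximum-dimension $\mathrm{VCm}(\phi)$ is the largest $d\in\mathbb N$ for which there are a countably infinite $A\subseteq M^k$ and a $d$-maximum family $\mathcal C\subseteq S_\phi(A)$ on $A$; it is $\infty$ if there are arbitrarily large such $d$, and $0$ if there is no such $d$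 (which can happen only when $M^k$ is finite). For real $r$, say that $\phi$ has $\mathrm{VC}_{\mathrm{ind}}$-density at most $r$ if there is $K\in\mathbb N$ such that for every $N\ge 1$ and every finite indiscernible sequence $\langle \mathbf b_i:i<N\rangle$ of elements of $M^k$ (indiscernible over $\emptyset$: any two increasing subsequences of the same length satisfy the same $L$-formulas), $|S_\phi(\{\mathbf b_i:i<N\})|<K\cdot N^r$. The $\mathrm{VC}_{\mathrm{ind}}$-density $\mathrm{VCd}_{\mathrm{ind}}(\phi)\in[-\infty,\infty]$ is the infimum of all such $r$, and $\infty$ if there is none. Then $\mathrm{VCm}(\phi)=\mathrm{VCd}_{\mathrm{ind}}(\phi)$. -/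

import Mathlib

universe u v w

namespace VCInd

/-! ### Set systems -/

/-- The trace of the set system `C` on `A`: all sets `S ∩ A` with `S` in `C`. -/
def trace {Y : Type*} (C : Set (Set Y)) (A : Set Y) : Set (Set Y) :=
  {T | ∃ S ∈ C, S ∩ A = T}

/-- The number of subsets of size at most `d` of a set with `n` elements
(this is `2 ^ n` when `n ≤ d`). -/
def chooseLE (n d : ℕ) : ℕ := ∑ i ∈ Finset.range (d + 1), n.choose i

/-- The set system `C` on `X` is `d`-maximum: its trace on every finite `A ⊆ X` has exactly
`chooseLE |A| d` members. -/
def IsMaximumOn {Y : Type*} (d : ℕ) (C : Set (Set Y)) (X : Set Y) : Prop :=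
  C ⊆ 𝒫 X ∧
    ∀ A : Finset Y, (A : Set Y) ⊆ X → (trace C (A : Set Y)).ncard = chooseLE A.card d

/-! ### Model theory -/

/-- `M` is `κ`-saturated: for every parameter set `A` of fewer than `κ` elements, every set of
formulas in finitely many variables with parameters from `A` that is finitely satisfiable in `M`
is realized in `M`. -/
def IsSaturated (L : FirstOrder.Language.{u, v}) (M : Type w) [L.Structure M] (κ : Cardinal.{w}) : Prop :=
  ∀ A : Set M, Cardinal.mk A < κ → ∀ (n : ℕ) (p : Set (L.Formula (A ⊕ Fin n))),
    (∀ q : Finset (L.Formula (A ⊕ Fin n)), (q : Set (L.Formula (A ⊕ Fin n))) ⊆ p →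
      ∃ c : Fin n → M, ∀ ψ ∈ q, ψ.Realize (Sum.elim (fun a : A => (a : M)) c)) →
    ∃ c : Fin n → M, ∀ ψ ∈ p, ψ.Realize (Sum.elim (fun a : A => (a : M)) c)

section

variable {L : FirstOrder.Language.{u, v}} {M : Type w} [L.Structure M] {l k : ℕ}

/-- `φ(b, a)` holds in `M`. -/
def Holds (φ : L.Formula (Fin l ⊕ Fin k)) (b : Fin l → M) (a : Fin k → M) : Prop :=
  φ.Realize (Sum.elim b a)

/-- The set of `φ`-types over `A`, each one identified with the set `P ⊆ A` of its positive
parameters. The set of formulas `φ(x, a)` for `a ∈ P` and `¬ φ(x, a)` for `a ∈ A \ P` has to be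
consistent (with the elementary diagram of `M`), that is, finitely satisfiable in `M`. -/
def phiTypes (φ : L.Formula (Fin l ⊕ Fin k)) (A : Set (Fin k → M)) : Set (Set (Fin k → M)) :=
  {P | P ⊆ A ∧ ∀ F : Finset (Fin k → M), (F : Set (Fin k → M)) ⊆ A →
    ∃ b : Fin l → M, ∀ a ∈ F, (Holds φ b a ↔ a ∈ P)}

/-- The finite sequence `s` of `k`-tuples is indiscernible (over the empty set): any two increasing
subsequences of the same length satisfy the same formulas. -/
def IsIndiscernible (L : FirstOrder.Language.{u, v}) {M : Type w} [L.Structure M] {k N : ℕ}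
    (s : Fin N → Fin k → M) : Prop :=
  ∀ (m : ℕ) (f g : Fin m ↪o Fin N) (ψ : L.Formula (Fin m × Fin k)),
    ψ.Realize (fun p => s (f p.1) p.2) ↔ ψ.Realize (fun p => s (g p.1) p.2)

variable (M) in
/-- The VC-maximum-dimension of `φ`: the largest `d` such that some set of `φ`-types over some
countably infinite set of `k`-tuples is `d`-maximum; it is `⊤` if there are arbitrarily large such
`d`, and `0` if there is none (which happens only if there are finitely many `k`-tuples). -/
noncomputable def VCm (φ : L.Formula (Fin l ⊕ Fin k)) : ℕ∞ :=
  sSup {e | ∃ d : ℕ, e = (d : ℕ∞) ∧ ∃ A : Set (Fin k → M), A.Countable ∧ A.Infinite ∧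
    ∃ C : Set (Set (Fin k → M)), C ⊆ phiTypes φ A ∧ IsMaximumOn d C A}

variable (M) in
/-- `φ` has VC_ind-density at most `r`: for some `K`, the number of `φ`-types over the range of any
nonempty finite indiscernible sequence of length `N` is less than `K * N ^ r`. -/
def VCIndDensityLE (φ : L.Formula (Fin l ⊕ Fin k)) (r : ℝ) : Prop :=
  ∃ K : ℕ, ∀ (N : ℕ) (s : Fin N → Fin k → M), 0 < N → IsIndiscernible L s →
    ((phiTypes φ (Set.range s)).ncard : ℝ) < K * (N : ℝ) ^ r

variable (M) in
/-- The VC_ind-density of `φ`: the infimum of the real `r` such that `φ` has VC_ind-density at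
most `r`, and `⊤` if there is no such `r`. -/
noncomputable def VCdInd (φ : L.Formula (Fin l ⊕ Fin k)) : EReal :=
  sInf {e | ∃ r : ℝ, e = (r : EReal) ∧ VCIndDensityLE M φ r}

end

end VCInd

/-! Maximum families bound the density from below. Given a `d`-maximum family of types on an
infinite `A`, iterate a nonprincipal ultrafilter on `A`: by saturation, any first-order property of
almost all `N`-tuples holds of some indiscernible sequence (`exists_indiscernible`). Realizing at
least `chooseLE N d` patterns is such a property, so no exponent below `d` works.

For the converse, read a type over a sequence as a binary word. A pattern of `d + 1` letters accepts
`chooseLE n d` words of length `n`, and accepted words are closed under subwords, so the accepted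
subsets of an injective sequence form a `d`-maximum family (`isMaximumOn_acceptedSets`). For fixed
`n`, all but `O(N ^ d)` words of length `N` contain every word of length at most `n` accepted by
some pattern of length `d + 2` (`exists_ncard_poorWords_le`). If the exponent `d` fails, some
indiscernible sequence realizes such a rich word, and indiscernibility moves its subwords to the
first `n` terms. Pigeonhole over patterns and saturation then give one infinite sequence for all
`n`, hence a `(d + 1)`-maximum family of types. -/

namespace VCInd

/-! ### Words accepted by a pattern

A pattern is a list of letters `e₀, …, e_d`. A word is accepted if it is a subword of
`e₀ … e₀ (!e₀) e₁ … e₁ (!e₁) … e_d … e_d`; we run the corresponding deterministic automaton, whose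
states are the suffixes of the pattern, the empty one being the failure state. -/

/-- One step of the automaton. -/
def step : List Bool → Bool → List Bool
  | [], _ => []
  | e :: es, b => if b = e then e :: es else es

/-- The word `w` is accepted by the pattern `es`. -/
def Accepts (es w : List Bool) : Prop := w.foldl step es ≠ []

theorem foldl_step_nil (w : List Bool) : w.foldl step [] = [] := by
  induction w with
  | nil => rfl
  | cons b w ih => exact ih

theorem not_accepts_nil (w : List Bool) : ¬ Accepts [] w := by
  simp [Accepts, foldl_step_nil]

theorem step_suffix (es : List Bool) (b : Bool) : step es b <:+ es := by
  cases es with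
  | nil => exact List.suffix_rfl
  | cons e es =>
    simp only [step]
    split_ifs
    · exact List.suffix_rfl
    · exact List.suffix_cons e es

theorem step_mono {es es' : List Bool} (h : es' <:+ es) (b : Bool) :
    step es' b <:+ step es b := by
  cases es with
  | nil => rw [List.suffix_nil.1 h]
  | cons e es =>
    rcases List.suffix_cons_iff.1 h with rfl | h
    · exact List.suffix_rfl
    · have h1 := (step_suffix es' b).trans h
      simp only [step]
      split_ifs
      · exact h1.trans (List.suffix_cons e es)
      · exact h1

theorem foldl_step_mono {es es' : List Bool} (h : es' <:+ es) (w : List Bool) :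
    w.foldl step es' <:+ w.foldl step es := by
  induction w generalizing es es' with
  | nil => exact h
  | cons b w ih => exact ih (step_mono h b)

/-- Each letter read can only shorten the state, and `step` is monotone for the suffix order, so
skipping letters leaves a longer state. -/
theorem foldl_step_sublist {v w : List Bool} (h : v.Sublist w) (es : List Bool) :
    w.foldl step es <:+ v.foldl step es := by
  induction h generalizing es with
  | slnil => exact List.suffix_rfl
  | cons b _ ih => exact (ih _).trans (foldl_step_mono (step_suffix es b) _)
  | cons_cons b _ ih => exact ih _

theorem Accepts.sublist {es v w : List Bool} (h : Accepts es w) (hv : v.Sublist w) :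
    Accepts es v := by
  intro h0
  have := foldl_step_sublist hv es
  rw [h0] at this
  exact h (List.suffix_nil.1 this)

theorem accepts_cons_self {e : Bool} {es w : List Bool} :
    Accepts (e :: es) (e :: w) ↔ Accepts (e :: es) w := by
  simp [Accepts, step]

theorem accepts_cons_not {e : Bool} {es w : List Bool} :
    Accepts (e :: es) ((!e) :: w) ↔ Accepts es w := by
  simp [Accepts, step]

theorem accepts_replicate (e : Bool) (es : List Bool) (n : ℕ) :
    Accepts (e :: es) (List.replicate n e) := by
  induction n with
  | zero => simp [Accepts]
  | succ n ih => rw [List.replicate_succ, accepts_cons_self]; exact ih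

/-- An accepted word remains accepted when a suitable letter is appended. -/
theorem Accepts.exists_append {es w : List Bool} (h : Accepts es w) :
    ∃ b, Accepts es (w ++ [b]) := by
  obtain ⟨e, t, ht⟩ := List.exists_cons_of_ne_nil h
  exact ⟨e, by simp [Accepts, ht, step]⟩

/-- The words of length `n` accepted by `es`. -/
def acceptedWords (es : List Bool) (n : ℕ) : Set (List Bool) := {w | w.length = n ∧ Accepts es w}

theorem finite_of_length_eq {S : Set (List Bool)} {n : ℕ} (h : ∀ w ∈ S, w.length = n) :
    S.Finite := (List.finite_length_eq Bool n).subset h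

theorem finite_acceptedWords (es : List Bool) (n : ℕ) : (acceptedWords es n).Finite :=
  finite_of_length_eq fun _ h => h.1

theorem acceptedWords_cons_succ (e : Bool) (es : List Bool) (n : ℕ) :
    acceptedWords (e :: es) (n + 1) =
      List.cons e '' acceptedWords (e :: es) n ∪ List.cons (!e) '' acceptedWords es n := by
  ext w
  constructor
  · rintro ⟨hl, hw⟩
    cases w with
    | nil => simp at hl
    | cons b w =>
      have hl' : w.length = n := by simpa using hl
      by_cases hb : b = e
      · subst hb
        exact Or.inl ⟨w, ⟨hl', accepts_cons_self.1 hw⟩, rfl⟩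
      · obtain rfl : b = !e := by cases b <;> cases e <;> simp_all
        exact Or.inr ⟨w, ⟨hl', accepts_cons_not.1 hw⟩, rfl⟩
  · rintro (⟨w, ⟨rfl, hw⟩, rfl⟩ | ⟨w, ⟨rfl, hw⟩, rfl⟩)
    · exact ⟨by simp, accepts_cons_self.2 hw⟩
    · exact ⟨by simp, accepts_cons_not.2 hw⟩

/-- Splitting on the first letter gives Pascal's recursion, so the count depends only on the length
of the pattern. -/
theorem ncard_acceptedWords (es : List Bool) (n : ℕ) :
    (acceptedWords es n).ncard = ∑ i ∈ Finset.range es.length, n.choose i := by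
  induction n generalizing es with
  | zero =>
    cases es with
    | nil => simp [acceptedWords, not_accepts_nil]
    | cons e es =>
      have : acceptedWords (e :: es) 0 = {[]} := by
        ext w
        simp only [acceptedWords, Set.mem_ofPred_eq, Set.mem_singleton_iff, List.length_eq_zero_iff]
        refine ⟨fun h => h.1, ?_⟩
        rintro rfl
        exact ⟨rfl, by simp [Accepts]⟩
      rw [this, Set.ncard_singleton, List.length_cons, Finset.sum_range_succ']
      simp
  | succ n ih =>
    cases es with
    | nil => simp [acceptedWords, not_accepts_nil]
    | cons e es =>
      rw [acceptedWords_cons_succ, Set.ncard_union_eq _ ((finite_acceptedWords _ _).image _)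
        ((finite_acceptedWords _ _).image _), Set.ncard_image_of_injective _ List.cons_injective,
        Set.ncard_image_of_injective _ List.cons_injective, ih, ih, List.length_cons,
        Finset.sum_range_succ', Finset.sum_range_succ' (fun i => (n + 1).choose i)]
      · simp only [Nat.choose_succ_succ, Finset.sum_add_distrib, Nat.choose_zero_right]
        ring
      · rw [Set.disjoint_left]
        rintro _ ⟨w, -, rfl⟩ ⟨w', -, h⟩
        simp at h

/-! ### Universal words -/

/-- Every word of length at most `n` accepted by `es` is a subword of `w`. -/
def Universal (es : List Bool) (n : ℕ) (w : List Bool) : Prop :=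
  ∀ v : List Bool, v.length ≤ n → Accepts es v → v.Sublist w

theorem Accepts.eq_replicate_or {e : Bool} {es v : List Bool} (h : Accepts (e :: es) v) :
    v = List.replicate v.length e ∨
      ∃ m v', v = List.replicate m e ++ (!e) :: v' ∧ Accepts es v' := by
  induction v with
  | nil => simp
  | cons b v ih =>
    by_cases hb : b = e
    · subst hb
      rcases ih (accepts_cons_self.1 h) with h1 | ⟨m, v', h1, h2⟩
      · left
        rw [List.length_cons, List.replicate_succ, ← h1]
      · right
        exact ⟨m + 1, v', by rw [List.replicate_succ, List.cons_append, ← h1], h2⟩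
    · obtain rfl : b = !e := by cases b <;> cases e <;> simp_all
      exact Or.inr ⟨0, v, rfl, accepts_cons_not.1 h⟩

theorem universal_singleton {e : Bool} {n : ℕ} {w : List Bool}
    (h : (List.replicate n e).Sublist w) : Universal [e] n w := by
  intro v hv hacc
  rcases hacc.eq_replicate_or with h1 | ⟨m, v', -, h2⟩
  · rw [h1]
    exact (List.replicate_sublist_replicate e |>.2 hv).trans h
  · exact absurd h2 (not_accepts_nil _)

/-- An accepted word is either a power of `e`, which fits in `u`, or such a power followed by `!e`
and a word accepted by `es`, which fits in `w`. -/
theorem Universal.cons {e : Bool} {es : List Bool} {n : ℕ} {u w : List Bool}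
    (hu : (List.replicate n e).Sublist u) (hw : Universal es n w) :
    Universal (e :: es) n (u ++ (!e) :: w) := by
  intro v hv hacc
  rcases hacc.eq_replicate_or with h1 | ⟨m, v', rfl, h2⟩
  · rw [h1]
    exact ((List.replicate_sublist_replicate e |>.2 hv).trans hu).trans
      (List.sublist_append_left _ _)
  · simp only [List.length_append, List.length_replicate, List.length_cons] at hv
    exact ((List.replicate_sublist_replicate e |>.2 (by omega)).trans hu).append
      ((hw v' (by omega) h2).cons_cons _)

/-- The words of length `N` that are universal for no pattern of length `j`. -/
def poorWords (j n N : ℕ) : Set (List Bool) :=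
  {w | w.length = N ∧ ∀ es : List Bool, es.length = j → ¬ Universal es n w}

theorem finite_poorWords (j n N : ℕ) : (poorWords j n N).Finite :=
  finite_of_length_eq fun _ h => h.1

theorem exists_replicate_sublist {n : ℕ} {w : List Bool} (h : 2 * n ≤ w.length) :
    ∃ e, (List.replicate n e).Sublist w := by
  simp only [List.replicate_sublist_iff]
  have := List.count_true_add_count_false w
  by_cases h1 : n ≤ w.count true
  · exact ⟨true, h1⟩
  · exact ⟨false, by omega⟩

theorem poorWords_one_eq_empty {n N : ℕ} (h : 2 * n ≤ N) : poorWords 1 n N = ∅ := by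
  refine Set.eq_empty_of_forall_notMem ?_
  rintro w ⟨rfl, hw⟩
  obtain ⟨e, he⟩ := exists_replicate_sublist h
  exact hw [e] rfl (universal_singleton he)

theorem ncard_words (n : ℕ) : {w : List Bool | w.length = n}.ncard = 2 ^ n := by
  rw [← Nat.card_coe_set_eq]
  have : Nat.card (List.Vector Bool n) = 2 ^ n := by simp
  exact this

theorem ncard_poorWords_le (j n N : ℕ) : (poorWords j n N).ncard ≤ 2 ^ N := by
  rw [← ncard_words]
  exact Set.ncard_le_ncard (fun _ h => h.1) (List.finite_length_eq Bool N)

theorem eq_replicate_or_append (e : Bool) (x : List Bool) :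
    x = List.replicate x.length e ∨ ∃ a y, x = List.replicate a e ++ (!e) :: y := by
  induction x with
  | nil => simp
  | cons b x ih =>
    by_cases hb : b = e
    · subst hb
      rcases ih with h1 | ⟨a, y, h1⟩
      · left
        rw [List.length_cons, List.replicate_succ, ← h1]
      · right
        exact ⟨a + 1, y, by rw [List.replicate_succ, List.cons_append, ← h1]⟩
    · obtain rfl : b = !e := by cases b <;> cases e <;> simp_all
      exact Or.inr ⟨0, x, rfl⟩

/-- Some letter `e` occurs `n` times among the first `2 * n` letters. The rest is constantly `e`, or
is a run of `e` followed by `!e` and a tail `y`; by `Universal.cons`, `y` is poor for `j`. So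
prefix, `e` and `y` determine the word. -/
theorem ncard_poorWords_succ_le (j n N : ℕ) :
    (poorWords (j + 1) n N).ncard ≤
      2 ^ (2 * n + 1) * (1 + ∑ m ∈ Finset.range N, (poorWords j n m).ncard) := by
  classical
  by_cases hN : N < 2 * n
  · calc (poorWords (j + 1) n N).ncard ≤ 2 ^ N := ncard_poorWords_le _ _ _
      _ ≤ 2 ^ (2 * n + 1) * 1 := by
        rw [mul_one]; exact Nat.pow_le_pow_right (by norm_num) (by omega)
      _ ≤ _ := Nat.mul_le_mul_left _ (by omega)
  push Not at hN
  let P : ℕ → Finset (List Bool) := fun m => (finite_poorWords j n m).toFinset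
  let U : Finset (List Bool) := (List.finite_length_eq Bool (2 * n)).toFinset
  let T : List Bool × Bool → Finset (List Bool) := fun p =>
    {p.1 ++ List.replicate (N - 2 * n) p.2} ∪
      (Finset.range N).biUnion fun m => (P m).image fun y =>
        p.1 ++ (List.replicate (N - 2 * n - m - 1) p.2 ++ (!p.2) :: y)
  have hsub : poorWords (j + 1) n N ⊆
      ((U ×ˢ (Finset.univ : Finset Bool)).biUnion T : Finset (List Bool)) := by
    rintro w ⟨hl, hw⟩
    have hu : (w.take (2 * n)).length = 2 * n := by simp [hl, hN]
    obtain ⟨e, he⟩ := exists_replicate_sublist hu.ge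
    have hx : (w.drop (2 * n)).length = N - 2 * n := by simp [hl]
    simp only [Finset.coe_biUnion, Set.mem_iUnion, Finset.mem_coe]
    refine ⟨(w.take (2 * n), e), by simp [U, hl, hN], ?_⟩
    simp only [T, Finset.mem_union, Finset.mem_singleton, Finset.mem_biUnion, Finset.mem_image,
      Finset.mem_range]
    rcases eq_replicate_or_append e (w.drop (2 * n)) with h1 | ⟨a, y, h1⟩
    · left
      rw [hx] at h1
      rw [← h1, List.take_append_drop]
    · right
      have hx' := hx
      rw [h1] at hx'
      simp only [List.length_append, List.length_replicate, List.length_cons] at hx'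
      have hw' : w = w.take (2 * n) ++ (List.replicate a e ++ (!e) :: y) := by
        rw [← h1, List.take_append_drop]
      refine ⟨y.length, by omega, y, ?_, ?_⟩
      · simp only [P, Set.Finite.mem_toFinset]
        refine ⟨rfl, fun es hes hun => hw (e :: es) (by simp [hes]) ?_⟩
        rw [hw', ← List.append_assoc]
        exact Universal.cons (he.trans (List.sublist_append_left _ _)) hun
      -- The length of the run of `e` is not a free parameter: `N` and the length of `y` fix it.
      · rw [show N - 2 * n - y.length - 1 = a by omega]
        exact hw'.symm
  calc (poorWords (j + 1) n N).ncard
      ≤ ((U ×ˢ (Finset.univ : Finset Bool)).biUnion T).card := by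
        rw [← Set.ncard_coe_finset]
        exact Set.ncard_le_ncard hsub (Finset.finite_toSet _)
    _ ≤ (U ×ˢ (Finset.univ : Finset Bool)).card *
        (1 + ∑ m ∈ Finset.range N, (poorWords j n m).ncard) := by
        refine Finset.card_biUnion_le_card_mul _ _ _ fun p _ => ?_
        refine (Finset.card_union_le _ _).trans (add_le_add (Finset.card_singleton _).le ?_)
        refine Finset.card_biUnion_le.trans (Finset.sum_le_sum fun m _ => ?_)
        refine Finset.card_image_le.trans ?_
        rw [Set.ncard_eq_toFinset_card _ (finite_poorWords j n m)]
    _ = _ := by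
        have hU : U.card = 2 ^ (2 * n) := by
          rw [← ncard_words, Set.ncard_eq_toFinset_card _ (List.finite_length_eq Bool (2 * n))]
        rw [Finset.card_product, hU]
        simp [pow_succ]

/-- For patterns of length 2 the sum in the recursion is bounded, as no word of length at least `2 *
n` is poor for length 1. Each further letter sums over `m < N` and raises the degree by one. -/
theorem exists_ncard_poorWords_le (d n : ℕ) :
    ∃ K : ℕ, ∀ N, (poorWords (d + 2) n N).ncard ≤ K * (N + 1) ^ d := by
  induction d with
  | zero =>
    refine ⟨2 ^ (2 * n + 1) * (1 + ∑ m ∈ Finset.range (2 * n), (poorWords 1 n m).ncard),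
      fun N => ?_⟩
    rw [pow_zero, mul_one]
    refine (ncard_poorWords_succ_le 1 n N).trans (Nat.mul_le_mul_left _ (Nat.add_le_add_left ?_ _))
    refine Finset.sum_le_sum_of_ne_zero fun m _ hm => ?_
    by_contra h
    rw [Finset.mem_range, not_lt] at h
    exact hm (by rw [poorWords_one_eq_empty h, Set.ncard_empty])
  | succ d ih =>
    obtain ⟨K, hK⟩ := ih
    refine ⟨2 ^ (2 * n + 1) * (1 + K), fun N => ?_⟩
    refine (ncard_poorWords_succ_le (d + 2) n N).trans ?_
    rw [mul_assoc]
    refine Nat.mul_le_mul_left _ ?_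
    have h1 : ∑ m ∈ Finset.range N, (poorWords (d + 2) n m).ncard ≤ N * (K * (N + 1) ^ d) := by
      refine (Finset.sum_le_card_nsmul _ _ (K * (N + 1) ^ d) fun m hm => ?_).trans (by simp)
      refine (hK m).trans (Nat.mul_le_mul_left _ (Nat.pow_le_pow_left ?_ _))
      have := Finset.mem_range.1 hm
      omega
    have h2 : 1 ≤ (N + 1) ^ (d + 1) := Nat.one_le_pow _ _ (by omega)
    have h3 : N * (K * (N + 1) ^ d) ≤ K * (N + 1) ^ (d + 1) := by
      rw [pow_succ]
      nlinarith [Nat.zero_le (K * (N + 1) ^ d)]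
    nlinarith

end VCInd
-- From maximum families to indiscernible sequences with many types
namespace VCInd

open FirstOrder FirstOrder.Language Filter

/-! ### Iterated powers of an ultrafilter -/

section Power

variable {Y : Type*}

/-- The `n`-th iterated (Fubini) power of an ultrafilter. -/
def power (U : Ultrafilter Y) : (n : ℕ) → Ultrafilter (Fin n → Y)
  | 0 => pure Fin.elim0
  | n + 1 => U.bind fun x => (power U n).map (Fin.cons (α := fun _ => Y) x)

theorem eventually_power_succ (U : Ultrafilter Y) (n : ℕ) (p : (Fin (n + 1) → Y) → Prop) :
    (∀ᶠ t in (power U (n + 1) : Filter _), p t) ↔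
      ∀ᶠ x in (U : Filter Y), ∀ᶠ t in (power U n : Filter _),
        p (Fin.cons (α := fun _ => Y) x t) := by
  rfl

theorem cons_apply_of_ne_zero {n : ℕ} (x : Y) (t : Fin n → Y) {i : Fin (n + 1)} (hi : i ≠ 0) :
    (Fin.cons x t : Fin (n + 1) → Y) i = t (i.pred hi) := by
  obtain ⟨j, rfl⟩ := Fin.exists_succ_eq.2 hi
  simp

/-- Coordinates missed by `f` are quantified vacuously and drop out. This invariance is the source
of indiscernibility. -/
theorem eventually_power_comp (U : Ultrafilter Y) {m n : ℕ} (f : Fin m → Fin n)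
    (hf : StrictMono f) (p : (Fin m → Y) → Prop) :
    (∀ᶠ t in (power U n : Filter _), p (t ∘ f)) ↔ ∀ᶠ t in (power U m : Filter _), p t := by
  induction n generalizing m with
  | zero =>
    cases m with
    | zero =>
      refine eventually_congr (Eventually.of_forall fun t => ?_)
      rw [Subsingleton.elim (t ∘ f) t]
    | succ m => exact (f 0).elim0
  | succ n ih =>
    cases m with
    | zero =>
      have h : ∀ t : Fin 0 → Y, p t ↔ p Fin.elim0 := fun t => by
        rw [Subsingleton.elim t Fin.elim0]
      simp only [h, eventually_const]
    | succ m =>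
      rw [eventually_power_succ]
      by_cases h0 : f 0 = 0
      · have hne : ∀ i : Fin m, f i.succ ≠ 0 := fun i =>
          (h0 ▸ hf (Fin.succ_pos i) : (0 : Fin (n + 1)) < f i.succ).ne'
        have hg : StrictMono fun i : Fin m => (f i.succ).pred (hne i) := fun i j hij =>
          Fin.pred_lt_pred_iff.2 (hf (Fin.succ_lt_succ_iff.2 hij))
        rw [eventually_power_succ]
        refine eventually_congr (Eventually.of_forall fun x => ?_)
        rw [← ih _ hg]
        refine eventually_congr (Eventually.of_forall fun t => ?_)
        have : (Fin.cons x t : Fin (n + 1) → Y) ∘ f =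
            Fin.cons x (t ∘ fun i : Fin m => (f i.succ).pred (hne i)) := by
          funext i
          refine Fin.cases ?_ (fun i => ?_) i
          · simp [h0]
          · exact cons_apply_of_ne_zero x t (hne i)
        rw [this]
      · have hne : ∀ i, f i ≠ 0 := fun i =>
          ((Fin.pos_iff_ne_zero.2 h0).trans_le (hf.monotone (Fin.zero_le i))).ne'
        have hg : StrictMono fun i => (f i).pred (hne i) := fun i j hij =>
          Fin.pred_lt_pred_iff.2 (hf hij)
        rw [← ih _ hg]
        have : ∀ (x : Y) (t : Fin n → Y), (Fin.cons x t : Fin (n + 1) → Y) ∘ f =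
            t ∘ fun i => (f i).pred (hne i) := by
          intro x t
          funext i
          exact cons_apply_of_ne_zero x t (hne i)
        simp only [this, eventually_const]

theorem eventually_power_forall {U : Ultrafilter Y} {p : Y → Prop}
    (hp : ∀ᶠ x in (U : Filter Y), p x) (n : ℕ) :
    ∀ᶠ t in (power U n : Filter (Fin n → Y)), ∀ i, p (t i) := by
  induction n with
  | zero => exact Eventually.of_forall fun t i => i.elim0
  | succ n ih =>
    rw [eventually_power_succ]
    filter_upwards [hp] with x hx
    filter_upwards [ih] with t ht
    exact Fin.cases hx ht

theorem eventually_power_injective {U : Ultrafilter Y}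
    (hU : ∀ y, ∀ᶠ x in (U : Filter Y), x ≠ y) (n : ℕ) :
    ∀ᶠ t in (power U n : Filter (Fin n → Y)), Function.Injective t := by
  induction n with
  | zero => exact Eventually.of_forall fun t => Function.injective_of_subsingleton t
  | succ n ih =>
    rw [eventually_power_succ]
    refine Eventually.of_forall fun x => ?_
    filter_upwards [ih, eventually_power_forall (hU x) n] with t ht ht'
    refine Fin.cons_injective_iff.2 ⟨?_, ht⟩
    rintro ⟨i, hi⟩
    exact ht' i hi

theorem exists_nonprincipal {A : Set Y} (hA : A.Infinite) :
    ∃ U : Ultrafilter Y, (∀ᶠ x in (U : Filter Y), x ∈ A) ∧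
      ∀ y, ∀ᶠ x in (U : Filter Y), x ≠ y := by
  have := hA.to_subtype
  refine ⟨(hyperfilter A).map Subtype.val, ?_, fun y => ?_⟩
  · exact Eventually.of_forall (f := (hyperfilter A : Filter A)) fun x => x.2
  · suffices h : ∀ᶠ x : A in hyperfilter A, (x : Y) ≠ y from h
    refine hyperfilter_le_cofinite ?_
    refine Set.Finite.subset (s := Subtype.val ⁻¹' {y})
      ((Set.finite_singleton y).preimage Subtype.val_injective.injOn) fun x hx => ?_
    simpa using hx

end Power

section

variable {L : FirstOrder.Language.{u, v}} {M : Type w} [L.Structure M] {l k : ℕ}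

/-! ### Indiscernible sequences -/

/-- The formulas true of almost all tuples form a finitely satisfiable type over `∅`; any
realization of it is indiscernible. -/
theorem exists_indiscernible (hM : IsSaturated L M (Cardinal.aleph 1))
    (U : Ultrafilter (Fin k → M)) {N : ℕ} (θ : L.Formula (Fin N × Fin k))
    (hθ : ∀ᶠ t in (power U N : Filter (Fin N → Fin k → M)), θ.Realize fun p => t p.1 p.2) :
    ∃ s : Fin N → Fin k → M, IsIndiscernible L s ∧ θ.Realize fun p => s p.1 p.2 := by
  let r : Fin N × Fin k → (∅ : Set M) ⊕ Fin (N * k) := fun p => Sum.inr (finProdFinEquiv p)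
  let val : (Fin N → Fin k → M) → Fin (N * k) → M := fun t i =>
    t (finProdFinEquiv.symm i).1 (finProdFinEquiv.symm i).2
  have hval : ∀ (ψ : L.Formula (Fin N × Fin k)) (c : Fin (N * k) → M),
      (ψ.relabel r).Realize (Sum.elim (fun a : (∅ : Set M) => (a : M)) c) ↔
        ψ.Realize fun p => c (finProdFinEquiv p) := by
    intro ψ c
    rw [Formula.realize_relabel]
    rfl
  obtain ⟨c, hc⟩ := hM ∅ (by simp) (N * k)
    {χ | ∃ ψ : L.Formula (Fin N × Fin k),
      (∀ᶠ t in (power U N : Filter (Fin N → Fin k → M)), ψ.Realize fun p => t p.1 p.2) ∧ χ = ψ.relabel r} (by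
    intro q hq
    have : ∀ᶠ t in (power U N : Filter (Fin N → Fin k → M)), ∀ χ ∈ q,
        χ.Realize (Sum.elim (fun a : (∅ : Set M) => (a : M)) (val t)) := by
      rw [eventually_all_finset]
      intro χ hχ
      obtain ⟨ψ, hψ, rfl⟩ := hq hχ
      filter_upwards [hψ] with t ht
      rw [hval]
      have hv : ∀ p, val t (finProdFinEquiv p) = t p.1 p.2 := fun p => by
        simp only [val, Equiv.symm_apply_apply]
      simpa only [hv] using ht
    obtain ⟨t, ht⟩ := this.exists
    exact ⟨val t, ht⟩)
  have key : ∀ ψ : L.Formula (Fin N × Fin k),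
      (∀ᶠ t in (power U N : Filter (Fin N → Fin k → M)), ψ.Realize fun p => t p.1 p.2) →
        ψ.Realize fun p => c (finProdFinEquiv p) := fun ψ hψ =>
    (hval ψ c).1 (hc _ ⟨ψ, hψ, rfl⟩)
  refine ⟨fun i j => c (finProdFinEquiv (i, j)), fun m f g ψ => ?_, key θ hθ⟩
  let ψf : L.Formula (Fin N × Fin k) := ψ.relabel fun p => (f p.1, p.2)
  let ψg : L.Formula (Fin N × Fin k) := ψ.relabel fun p => (g p.1, p.2)
  have hcomp : ∀ (χ : L.Formula (Fin m × Fin k)) (h : Fin m ↪o Fin N),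
      (∀ᶠ t in (power U N : Filter (Fin N → Fin k → M)), χ.Realize fun p => t (h p.1) p.2) ↔
        ∀ᶠ t in (power U m : Filter (Fin m → Fin k → M)), χ.Realize fun p => t p.1 p.2 := fun χ h =>
    eventually_power_comp U h h.strictMono fun t => χ.Realize fun p => t p.1 p.2
  -- Both sides are governed by `power U m`, which decides `ψ`, so the equivalence holds almost
  -- everywhere.
  have hiff : (ψf.iff ψg).Realize fun p => c (finProdFinEquiv p) := by
    apply key
    simp only [Formula.realize_iff, ψf, ψg, Formula.realize_relabel, Function.comp_def]
    by_cases h : ∀ᶠ t in (power U m : Filter (Fin m → Fin k → M)), ψ.Realize fun p => t p.1 p.2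
    · filter_upwards [(hcomp ψ f).2 h, (hcomp ψ g).2 h] with t h1 h2
      exact iff_of_true h1 h2
    · rw [← Ultrafilter.eventually_not] at h
      filter_upwards [(hcomp ψ.not f).2 h, (hcomp ψ.not g).2 h] with t h1 h2
      exact iff_of_false h1 h2
  simpa only [Formula.realize_iff, ψf, ψg, Formula.realize_relabel, Function.comp_def] using hiff

/-! ### Realized patterns -/

/-- The sets of positions cut out on the sequence `t` by the instances of `φ`. -/
def patterns (φ : L.Formula (Fin l ⊕ Fin k)) {n : ℕ} (t : Fin n → Fin k → M) :
    Set (Fin n → Bool) :=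
  {v | ∃ b : Fin l → M, ∀ i, Holds φ b (t i) ↔ v i = true}

/-- The formula expressing that the pattern `v` is realized. -/
noncomputable def patternFormula (φ : L.Formula (Fin l ⊕ Fin k)) {n : ℕ} (v : Fin n → Bool) :
    L.Formula (Fin n × Fin k) :=
  Formula.iExs (Fin l) <| Formula.iInf fun i : Fin n =>
    if v i = true then φ.relabel (Sum.elim Sum.inr fun j => Sum.inl (i, j))
    else (φ.relabel (Sum.elim Sum.inr fun j => Sum.inl (i, j))).not

theorem realize_patternFormula (φ : L.Formula (Fin l ⊕ Fin k)) {n : ℕ} (v : Fin n → Bool)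
    (t : Fin n → Fin k → M) :
    ((patternFormula φ v).Realize fun p => t p.1 p.2) ↔ v ∈ patterns φ t := by
  have h : ∀ (b : Fin l → M) (i : Fin n),
      (Sum.elim (fun p : Fin n × Fin k => t p.1 p.2) b ∘
        (Sum.elim Sum.inr fun j => Sum.inl (i, j))) = Sum.elim b (t i) := by
    intro b i
    funext x
    cases x <;> rfl
  simp only [patternFormula, Formula.realize_iExs, Formula.realize_iInf, patterns,
    Set.mem_ofPred_eq]
  refine exists_congr fun b => forall_congr' fun i => ?_
  split_ifs with hv
  · rw [Formula.realize_relabel, h]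
    simp [Holds, hv]
  · rw [Formula.realize_not, Formula.realize_relabel, h]
    simp [Holds, hv]

theorem mem_patterns_comp {φ : L.Formula (Fin l ⊕ Fin k)} {n m : ℕ} {t : Fin n → Fin k → M}
    {v : Fin n → Bool} (h : v ∈ patterns φ t) (f : Fin m → Fin n) : v ∘ f ∈ patterns φ (t ∘ f) :=
  let ⟨b, hb⟩ := h
  ⟨b, fun i => hb (f i)⟩

/-- Types over a finite set are realized. Repetitions in `t` do no harm: a pattern takes equal
values at equal terms. -/
theorem ncard_phiTypes_range (φ : L.Formula (Fin l ⊕ Fin k)) {n : ℕ} (t : Fin n → Fin k → M) :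
    (phiTypes φ (Set.range t)).ncard = (patterns φ t).ncard := by
  classical
  have himage : patterns φ t =
      (fun P : Set (Fin k → M) => fun i => decide (t i ∈ P)) '' phiTypes φ (Set.range t) := by
    ext v
    constructor
    · rintro ⟨b, hb⟩
      refine ⟨{y | y ∈ Set.range t ∧ Holds φ b y}, ⟨fun y hy => hy.1, fun F hF => ⟨b, ?_⟩⟩, ?_⟩
      · intro y hy
        simp only [Set.mem_ofPred_eq]
        exact ⟨fun h => ⟨hF hy, h⟩, fun h => h.2⟩
      · funext i
        rw [Bool.eq_iff_iff, ← hb i]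
        simp
    · rintro ⟨P, ⟨-, hP⟩, rfl⟩
      obtain ⟨b, hb⟩ := hP (Finset.univ.image t) (by simp)
      exact ⟨b, fun i => by simpa using hb (t i) (by simp)⟩
  rw [himage, Set.InjOn.ncard_image]
  intro P hP Q hQ hPQ
  ext y
  constructor
  · intro hy
    obtain ⟨i, rfl⟩ := hP.1 hy
    have := congrFun hPQ i
    simpa [hy] using this
  · intro hy
    obtain ⟨i, rfl⟩ := hQ.1 hy
    have := congrFun hPQ i
    simpa [hy] using this

/-- The formula expressing that at least `c` patterns are realized. -/
noncomputable def countFormula (φ : L.Formula (Fin l ⊕ Fin k)) (n c : ℕ) :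
    L.Formula (Fin n × Fin k) :=
  Formula.iSup fun W : {W : Finset (Fin n → Bool) // W.card = c} =>
    Formula.iInf fun v : W.1 => patternFormula φ v.1

theorem realize_countFormula (φ : L.Formula (Fin l ⊕ Fin k)) {n c : ℕ} (t : Fin n → Fin k → M) :
    ((countFormula φ n c).Realize fun p => t p.1 p.2) ↔ c ≤ (patterns φ t).ncard := by
  simp only [countFormula, Formula.realize_iSup, Formula.realize_iInf, realize_patternFormula]
  constructor
  · rintro ⟨⟨W, rfl⟩, hW⟩
    rw [← Set.ncard_coe_finset]
    exact Set.ncard_le_ncard (fun v hv => hW ⟨v, hv⟩) (Set.toFinite _)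
  · intro h
    obtain ⟨W, hW, hc⟩ := Set.exists_subset_card_eq h
    have hfin : W.Finite := Set.toFinite _
    refine ⟨⟨hfin.toFinset, by rw [← Set.ncard_eq_toFinset_card _ hfin, hc]⟩, fun v => hW ?_⟩
    exact hfin.mem_toFinset.1 v.2

theorem chooseLE_le_ncard_patterns {φ : L.Formula (Fin l ⊕ Fin k)} {A : Set (Fin k → M)}
    {C : Set (Set (Fin k → M))} {d : ℕ} (hC : C ⊆ phiTypes φ A) (hd : IsMaximumOn d C A) {n : ℕ}
    {t : Fin n → Fin k → M} (ht : Function.Injective t) (htA : ∀ i, t i ∈ A) :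
    chooseLE n d ≤ (patterns φ t).ncard := by
  classical
  have hF : ((Finset.univ.image t : Finset _) : Set (Fin k → M)) ⊆ A := by
    rintro _ h
    obtain ⟨i, -, rfl⟩ := Finset.mem_image.1 (Finset.mem_coe.1 h)
    exact htA i
  have hcard := hd.2 _ hF
  rw [Finset.card_image_of_injective _ ht, Finset.card_univ, Fintype.card_fin] at hcard
  rw [← hcard]
  refine Set.ncard_le_ncard_of_injOn (fun T i => decide (t i ∈ T)) ?_ ?_ (Set.toFinite _)
  · rintro _ ⟨S, hS, rfl⟩
    obtain ⟨b, hb⟩ := (hC hS).2 _ hF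
    exact ⟨b, fun i => by simpa using hb (t i) (by simp)⟩
  · rintro _ ⟨S, -, rfl⟩ _ ⟨S', -, rfl⟩ h
    ext y
    simp only [Set.mem_inter_iff, and_congr_left_iff]
    intro hy
    obtain ⟨i, -, rfl⟩ := Finset.mem_image.1 (Finset.mem_coe.1 hy)
    have := congrFun h i
    simpa using this

/-! ### Lower bounds on the density -/

theorem exists_indiscernible_chooseLE_le (hM : IsSaturated L M (Cardinal.aleph 1))
    {φ : L.Formula (Fin l ⊕ Fin k)} {A : Set (Fin k → M)} (hA : A.Infinite)
    {C : Set (Set (Fin k → M))} {d : ℕ} (hC : C ⊆ phiTypes φ A) (hd : IsMaximumOn d C A) (N : ℕ) :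
    ∃ s : Fin N → Fin k → M, IsIndiscernible L s ∧
      chooseLE N d ≤ (phiTypes φ (Set.range s)).ncard := by
  obtain ⟨U, hUA, hU⟩ := exists_nonprincipal hA
  obtain ⟨s, hs, hc⟩ := exists_indiscernible hM U (countFormula φ N (chooseLE N d)) (by
    filter_upwards [eventually_power_forall hUA N, eventually_power_injective hU N] with t h1 h2
    rw [realize_countFormula]
    exact chooseLE_le_ncard_patterns hC hd h2 h1)
  refine ⟨s, hs, ?_⟩
  rwa [ncard_phiTypes_range, ← realize_countFormula]

/-- `chooseLE N d` is at least `N.choose d`, which grows like `N ^ d`. -/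
theorem natCast_le_of_chooseLE_le {d K : ℕ} {r : ℝ}
    (h : ∀ N : ℕ, 0 < N → (chooseLE N d : ℝ) < K * (N : ℝ) ^ r) : (d : ℝ) ≤ r := by
  by_contra! hr
  -- Put `N = x + d`: then `N.choose d ≥ (x + 1) ^ d / d!`, while `N ≤ (d + 1) * x`.
  have h1 : ∀ x : ℕ, 1 ≤ x →
      1 ≤ (d.factorial * K * (d + 1) ^ d : ℝ) * (x : ℝ) ^ (r - d) := by
    intro x hx
    have hx0 : (0 : ℝ) < x := by exact_mod_cast hx
    have hN0 : (0 : ℝ) < (x + d : ℕ) := by exact_mod_cast (by omega : 0 < x + d)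
    have hfac : (0 : ℝ) < d.factorial := by exact_mod_cast d.factorial_pos
    have h2 : (((x + d + 1 - d : ℕ) : ℝ) ^ d) / d.factorial ≤ ((x + d).choose d : ℝ) := by
      exact_mod_cast Nat.pow_le_choose (α := ℝ) d (x + d)
    rw [show x + d + 1 - d = x + 1 by omega, div_le_iff₀ hfac] at h2
    have h3 : ((x + d).choose d : ℝ) ≤ chooseLE (x + d) d := by
      unfold chooseLE
      exact_mod_cast Finset.single_le_sum (f := fun i => (x + d).choose i)
        (fun i _ => Nat.zero_le _) (Finset.self_mem_range_succ d)
    have h4 := h (x + d) (by omega)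
    have h5 : ((x + d : ℕ) : ℝ) ^ r = ((x + d : ℕ) : ℝ) ^ d * ((x + d : ℕ) : ℝ) ^ (r - d) := by
      rw [← Real.rpow_natCast, ← Real.rpow_add hN0]
      congr 1
      ring
    have h6 : ((x + d : ℕ) : ℝ) ^ (r - d) ≤ (x : ℝ) ^ (r - d) :=
      Real.rpow_le_rpow_of_nonpos hx0 (by push_cast; linarith [Nat.cast_nonneg (α := ℝ) d])
        (by linarith)
    have h7 : ((x + d : ℕ) : ℝ) ^ d ≤ (d + 1) ^ d * (x : ℝ) ^ d := by
      rw [← mul_pow]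
      refine pow_le_pow_left₀ hN0.le ?_ _
      have : (1 : ℝ) ≤ x := by exact_mod_cast hx
      push_cast
      nlinarith [Nat.cast_nonneg (α := ℝ) d]
    have hxd : (0 : ℝ) < (x : ℝ) ^ d := by positivity
    have h8 : (x : ℝ) ^ d ≤ ((x + 1 : ℕ) : ℝ) ^ d :=
      pow_le_pow_left₀ hx0.le (by push_cast; linarith) _
    have h9 : ((x + d : ℕ) : ℝ) ^ r ≤ (d + 1) ^ d * (x : ℝ) ^ d * (x : ℝ) ^ (r - d) := by
      rw [h5]
      exact mul_le_mul h7 h6 (by positivity) (by positivity)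
    have h10 : (x : ℝ) ^ d ≤
        (x : ℝ) ^ d * ((d.factorial * K * (d + 1) ^ d : ℝ) * (x : ℝ) ^ (r - d)) := by
      calc (x : ℝ) ^ d ≤ ((x + d).choose d : ℝ) * d.factorial := h8.trans h2
        _ ≤ (K * ((x + d : ℕ) : ℝ) ^ r) * d.factorial :=
          mul_le_mul_of_nonneg_right (h3.trans h4.le) hfac.le
        _ ≤ (K * ((d + 1) ^ d * (x : ℝ) ^ d * (x : ℝ) ^ (r - d))) * d.factorial := by gcongr
        _ = _ := by ring
    exact le_of_mul_le_mul_left (by simpa using h10) hxd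
  have hlim : Tendsto (fun x : ℕ => (d.factorial * K * (d + 1) ^ d : ℝ) * (x : ℝ) ^ (r - d))
      atTop (nhds 0) := by
    have := ((tendsto_rpow_neg_atTop (sub_pos.2 hr)).comp
      (tendsto_natCast_atTop_atTop (R := ℝ))).const_mul (d.factorial * K * (d + 1) ^ d : ℝ)
    simpa [Function.comp_def] using this
  have := ge_of_tendsto hlim (eventually_atTop.2 ⟨1, h1⟩)
  linarith

theorem isIndiscernible_const {N : ℕ} (y : Fin k → M) :
    IsIndiscernible L (fun _ : Fin N => y) := fun _ _ _ _ => Iff.rfl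

/-- Constant sequences are indiscernible of every length and carry at least one type. Negative `r`,
where `⌊r⌋₊ = 0` exceeds `r`, are thus excluded. -/
theorem VCIndDensityLE.nonneg [Nonempty M] {φ : L.Formula (Fin l ⊕ Fin k)} {r : ℝ}
    (h : VCIndDensityLE M φ r) : 0 ≤ r := by
  obtain ⟨K, hK⟩ := h
  have := natCast_le_of_chooseLE_le (d := 0) (K := K) (r := r) fun N hN => by
    let x : M := Classical.arbitrary M
    refine lt_of_le_of_lt ?_ (hK N (fun _ _ => x) hN (isIndiscernible_const _))
    rw [ncard_phiTypes_range]
    classical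
    have : 0 < (patterns φ fun (_ : Fin N) (_ : Fin k) => x).ncard := by
      rw [Set.ncard_pos (Set.toFinite _)]
      exact ⟨fun i => decide (Holds φ (fun _ => x) fun _ => x), fun _ => x, fun i => by simp⟩
    simp only [chooseLE, zero_add, Finset.range_one, Finset.sum_singleton, Nat.choose_zero_right]
    exact_mod_cast this
  simpa using this

theorem VCm_le_of_vcIndDensityLE [Nonempty M] (hM : IsSaturated L M (Cardinal.aleph 1))
    {φ : L.Formula (Fin l ⊕ Fin k)} {r : ℝ} (h : VCIndDensityLE M φ r) :
    VCm M φ ≤ (⌊r⌋₊ : ℕ∞) := by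
  refine sSup_le ?_
  rintro _ ⟨d, rfl, A, -, hA, C, hC, hd⟩
  have hr := h.nonneg
  obtain ⟨K, hK⟩ := h
  have : (d : ℝ) ≤ r := natCast_le_of_chooseLE_le (K := K) fun N hN => by
    obtain ⟨s, hs, hc⟩ := exists_indiscernible_chooseLE_le hM hA hC hd N
    exact lt_of_le_of_lt (by exact_mod_cast hc) (hK N s hN hs)
  exact_mod_cast Nat.le_floor this

end

end VCInd
-- From large density to maximum families of types
namespace VCInd

open FirstOrder FirstOrder.Language Filter

section

variable {L : FirstOrder.Language.{u, v}} {M : Type w} [L.Structure M] {l k : ℕ}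

/-! ### Realizing all accepted words -/

/-- All words accepted by `es` are realized on the first `n` terms of `t`. -/
def RealizesAccepted (φ : L.Formula (Fin l ⊕ Fin k)) (es : List Bool) (n : ℕ)
    (t : ℕ → Fin k → M) : Prop :=
  ∀ v : Fin n → Bool, Accepts es (List.ofFn v) → v ∈ patterns φ fun i : Fin n => t i

theorem RealizesAccepted.of_succ {φ : L.Formula (Fin l ⊕ Fin k)} {es : List Bool} {n : ℕ}
    {t : ℕ → Fin k → M} (h : RealizesAccepted φ es (n + 1) t) : RealizesAccepted φ es n t := by
  intro v hv
  obtain ⟨b, hb⟩ := hv.exists_append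
  have h1 : List.ofFn (Fin.snoc v b : Fin (n + 1) → Bool) = List.ofFn v ++ [b] := by
    rw [List.ofFn_succ']
    simp
  have h2 := mem_patterns_comp (h (Fin.snoc v b) (h1 ▸ hb)) Fin.castSucc
  have h3 : (Fin.snoc v b : Fin (n + 1) → Bool) ∘ Fin.castSucc = v := by
    funext i
    simp
  rw [h3] at h2
  exact h2

theorem RealizesAccepted.mono {φ : L.Formula (Fin l ⊕ Fin k)} {es : List Bool} {m n : ℕ}
    {t : ℕ → Fin k → M} (h : RealizesAccepted φ es n t) (hmn : m ≤ n) :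
    RealizesAccepted φ es m t := by
  induction n, hmn using Nat.le_induction with
  | base => exact h
  | succ n _ ih => exact ih h.of_succ

theorem RealizesAccepted.congr {φ : L.Formula (Fin l ⊕ Fin k)} {es : List Bool} {n : ℕ}
    {t t' : ℕ → Fin k → M} (h : RealizesAccepted φ es n t) (htt : ∀ i < n, t i = t' i) :
    RealizesAccepted φ es n t' := by
  have : (fun i : Fin n => t i) = fun i : Fin n => t' i := funext fun i => htt i i.2
  unfold RealizesAccepted
  rw [← this]
  exact h

/-- The formula expressing that all accepted words of length `n` are realized. -/
noncomputable def acceptedFormula (φ : L.Formula (Fin l ⊕ Fin k)) (es : List Bool) (n : ℕ) :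
    L.Formula (Fin n × Fin k) :=
  Formula.iInf fun v : {v : Fin n → Bool // Accepts es (List.ofFn v)} => patternFormula φ v.1

theorem realize_acceptedFormula {φ : L.Formula (Fin l ⊕ Fin k)} {es : List Bool} {n : ℕ}
    {t : ℕ → Fin k → M} :
    ((acceptedFormula φ es n).Realize fun p => t p.1 p.2) ↔ RealizesAccepted φ es n t := by
  have h := fun v : Fin n → Bool => realize_patternFormula φ v fun i : Fin n => t i
  simp only [acceptedFormula, Formula.realize_iInf, h, Subtype.forall]
  rfl

theorem exists_comp_of_sublist_ofFn {n N : ℕ} {v : Fin n → Bool} {w : Fin N → Bool}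
    (h : (List.ofFn v).Sublist (List.ofFn w)) : ∃ f : Fin n ↪o Fin N, v = w ∘ f := by
  obtain ⟨f, hf⟩ := List.sublist_iff_exists_fin_orderEmbedding_get_eq.1 h
  refine ⟨((Fin.castOrderIso (List.length_ofFn (f := v)).symm).toOrderEmbedding.trans f).trans
    (Fin.castOrderIso (List.length_ofFn (f := w))).toOrderEmbedding, ?_⟩
  funext i
  have := hf (Fin.cast (List.length_ofFn (f := v)).symm i)
  simp only [List.get_eq_getElem, List.getElem_ofFn] at this
  exact this

/-- Every accepted word of length `n` is read off `w` at some increasing positions `f`;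
indiscernibility transfers it to the initial positions `g`. -/
theorem exists_realizesAccepted_of_universal [Nonempty M] {φ : L.Formula (Fin l ⊕ Fin k)} {N : ℕ}
    {s : Fin N → Fin k → M} (hs : IsIndiscernible L s) {es : List Bool} (hes : es ≠ []) {n : ℕ}
    {w : Fin N → Bool} (hw : w ∈ patterns φ s) (hu : Universal es n (List.ofFn w)) :
    ∃ t : ℕ → Fin k → M, RealizesAccepted φ es n t := by
  obtain ⟨e, es', rfl⟩ := List.exists_cons_of_ne_nil hes
  have hle : n ≤ N := by
    simpa using (hu _ (by simp) (accepts_replicate e es' n)).length_le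
  let g : Fin n ↪o Fin N := Fin.castLEOrderEmb hle
  let t : ℕ → Fin k → M := fun i => if h : i < N then s ⟨i, h⟩ else fun _ => Classical.arbitrary M
  have ht : (fun i : Fin n => t i) = fun i => s (g i) :=
    funext fun i => dif_pos (i.2.trans_le hle)
  refine ⟨t, fun v hv => ?_⟩
  obtain ⟨f, rfl⟩ := exists_comp_of_sublist_ofFn (hu _ (by simp) hv)
  have h1 := mem_patterns_comp hw f
  rw [← realize_patternFormula] at h1
  have h2 := (hs n f g (patternFormula φ (w ∘ f))).1 h1
  rw [realize_patternFormula φ (w ∘ f) fun i => s (g i)] at h2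
  rwa [ht]

theorem exists_realizesAccepted [Nonempty M] {φ : L.Formula (Fin l ⊕ Fin k)} {d : ℕ}
    (h : ¬ VCIndDensityLE M φ d) (n : ℕ) :
    ∃ es : List Bool, es.length = d + 2 ∧ ∃ t : ℕ → Fin k → M, RealizesAccepted φ es n t := by
  obtain ⟨K, hK⟩ := exists_ncard_poorWords_le d n
  unfold VCIndDensityLE at h
  push Not at h
  -- Since `N + 1 ≤ 2 * N`, this constant beats the bound `K * (N + 1) ^ d` on poor words.
  obtain ⟨N, s, hN, hs, hc⟩ := h (K * 2 ^ d + 1)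
  have hlt : (poorWords (d + 2) n N).ncard < (patterns φ s).ncard := by
    rw [ncard_phiTypes_range, Real.rpow_natCast] at hc
    have hc' : (K * 2 ^ d + 1) * N ^ d ≤ (patterns φ s).ncard := by exact_mod_cast hc
    refine lt_of_lt_of_le ?_ hc'
    calc (poorWords (d + 2) n N).ncard ≤ K * (N + 1) ^ d := hK N
      _ ≤ K * (2 * N) ^ d := Nat.mul_le_mul_left _ (Nat.pow_le_pow_left (by omega) _)
      _ < (K * 2 ^ d + 1) * N ^ d := by
        have : 0 < N ^ d := pow_pos hN d
        rw [mul_pow, add_mul, mul_assoc]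
        omega
  obtain ⟨w, hw, hpoor⟩ : ∃ w ∈ patterns φ s, List.ofFn w ∉ poorWords (d + 2) n N := by
    by_contra! hcon
    exact hlt.not_ge (Set.ncard_le_ncard_of_injOn List.ofFn hcon
      List.ofFn_injective.injOn (finite_poorWords _ _ _))
  simp only [poorWords, Set.mem_ofPred_eq, List.length_ofFn, true_and, not_forall, not_not] at hpoor
  obtain ⟨es, hes, hu⟩ := hpoor
  exact ⟨es, hes, exists_realizesAccepted_of_universal hs (by rintro rfl; simp at hes) hw hu⟩

/-- There are finitely many patterns of length `d + 2`; if each failed at some length, all would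
fail at a common bound. -/
theorem exists_forall_realizesAccepted [Nonempty M] {φ : L.Formula (Fin l ⊕ Fin k)} {d : ℕ}
    (h : ¬ VCIndDensityLE M φ d) :
    ∃ es : List Bool, es.length = d + 2 ∧
      ∀ n, ∃ t : ℕ → Fin k → M, RealizesAccepted φ es n t := by
  by_contra! hcon
  choose! f hf using hcon
  obtain ⟨B, hB⟩ := ((List.finite_length_eq Bool (d + 2)).image f).bddAbove
  obtain ⟨es, hes, t, ht⟩ := exists_realizesAccepted h B
  exact hf es hes t (ht.mono (hB ⟨es, hes, rfl⟩))

/-- The first `m` terms of `t` can be continued to arbitrarily long sequences on which all accepted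
words are realized. -/
def Extendable (φ : L.Formula (Fin l ⊕ Fin k)) (es : List Bool) (m : ℕ) (t : ℕ → Fin k → M) :
    Prop :=
  ∀ N, ∃ t' : ℕ → Fin k → M, (∀ i < m, t' i = t i) ∧ RealizesAccepted φ es N t'

/-- Saturation handles finitely many variables, so the sequence is built term by term, over the
finite set of coordinates already chosen. -/
theorem Extendable.exists_update (hM : IsSaturated L M (Cardinal.aleph 1))
    {φ : L.Formula (Fin l ⊕ Fin k)} {es : List Bool} {m : ℕ} {t : ℕ → Fin k → M}
    (h : Extendable φ es m t) : ∃ c : Fin k → M, Extendable φ es (m + 1) (Function.update t m c) := by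
  classical
  let P : Set M := ⋃ i ∈ Finset.range m, Set.range (t i)
  have hPfin : P.Finite := Set.Finite.biUnion (Finset.finite_toSet _) fun i _ => Set.finite_range _
  have hP : ∀ i < m, ∀ j, t i j ∈ P := fun i hi j =>
    Set.mem_biUnion (Finset.mem_range.2 hi) ⟨j, rfl⟩
  -- Positions before `m` become parameters, position `m` the free variables, later positions are
  -- quantified.
  let g : (N : ℕ) → Fin N × Fin k → (P ⊕ Fin k) ⊕ (Fin N × Fin k) := fun N p =>
    if hi : (p.1 : ℕ) < m then Sum.inl (Sum.inl ⟨t p.1 p.2, hP p.1 hi p.2⟩)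
    else if (p.1 : ℕ) = m then Sum.inl (Sum.inr p.2) else Sum.inr p
  let D : ℕ → L.Formula (P ⊕ Fin k) := fun N =>
    Formula.iExs (Fin N × Fin k) ((acceptedFormula φ es N).relabel (g N))
  have hg : ∀ (N : ℕ) (c : Fin k → M) (x : Fin N × Fin k → M) (t' : ℕ → Fin k → M),
      (∀ i < m, t' i = t i) → t' m = c → (∀ p : Fin N × Fin k, m < p.1 → t' p.1 p.2 = x p) →
      (Sum.elim (Sum.elim (fun a : P => (a : M)) c) x) ∘ g N = fun p => t' p.1 p.2 := by
    intro N c x t' h1 h2 h3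
    funext p
    simp only [Function.comp_apply, g]
    split_ifs with h4 h5
    · simp [h1 _ h4]
    · simp [h5, h2]
    · simp [h3 p (by omega)]
  have hD : ∀ (N : ℕ) (c : Fin k → M),
      (D N).Realize (Sum.elim (fun a : P => (a : M)) c) ↔
        ∃ t' : ℕ → Fin k → M, (∀ i < m, t' i = t i) ∧ t' m = c ∧ RealizesAccepted φ es N t' := by
    intro N c
    simp only [D, Formula.realize_iExs, Formula.realize_relabel]
    constructor
    · rintro ⟨x, hx⟩
      let t' : ℕ → Fin k → M := fun i => if i < m then t i else if i = m then c else
        if hi : i < N then fun j => x (⟨i, hi⟩, j) else c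
      have h1 : ∀ i < m, t' i = t i := fun i hi => if_pos hi
      have h2 : t' m = c := by simp [t']
      refine ⟨t', h1, h2, ?_⟩
      rw [hg N c x t' h1 h2 (fun p hp => by
        simp [t', show ¬ (p.1 : ℕ) < m by omega, show ¬ (p.1 : ℕ) = m by omega])] at hx
      exact realize_acceptedFormula.1 hx
    · rintro ⟨t', h1, h2, h3⟩
      refine ⟨fun p => t' p.1 p.2, ?_⟩
      rw [hg N c _ t' h1 h2 fun _ _ => rfl]
      exact realize_acceptedFormula.2 h3
  obtain ⟨c, hc⟩ := hM P ((Cardinal.lt_aleph0_iff_set_finite.2 hPfin).trans_le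
    (Cardinal.aleph0_le_aleph 1)) k (Set.range D) (by
      intro q hq
      choose! ν hν using hq
      obtain ⟨t', h1, h2⟩ := h (q.sup ν)
      refine ⟨t' m, fun ψ hψ => ?_⟩
      rw [← hν hψ, hD]
      exact ⟨t', h1, rfl, h2.mono (Finset.le_sup hψ)⟩)
  refine ⟨c, fun N => ?_⟩
  obtain ⟨t', h1, h2, h3⟩ := (hD N c).1 (hc _ ⟨N, rfl⟩)
  refine ⟨t', fun i hi => ?_, h3⟩
  rcases Nat.lt_succ_iff_lt_or_eq.1 hi with hi | rfl
  · rw [Function.update_of_ne hi.ne, h1 i hi]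
  · rw [Function.update_self, h2]

theorem exists_sequence_realizesAccepted [Nonempty M]
    (hM : IsSaturated L M (Cardinal.aleph 1)) {φ : L.Formula (Fin l ⊕ Fin k)} {es : List Bool}
    (h : ∀ n, ∃ t : ℕ → Fin k → M, RealizesAccepted φ es n t) :
    ∃ a : ℕ → Fin k → M, ∀ n, RealizesAccepted φ es n a := by
  have hstep : ∀ (m : ℕ) (t : ℕ → Fin k → M), ∃ c : Fin k → M,
      Extendable φ es m t → Extendable φ es (m + 1) (Function.update t m c) := by
    intro m t
    by_cases ht : Extendable φ es m t
    · obtain ⟨c, hc⟩ := ht.exists_update hM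
      exact ⟨c, fun _ => hc⟩
    · exact ⟨fun _ => Classical.arbitrary M, fun h => absurd h ht⟩
  choose next hnext using hstep
  let T : ℕ → ℕ → Fin k → M := fun m => Nat.rec (fun _ _ => Classical.arbitrary M)
    (fun m t => Function.update t m (next m t)) m
  have hTs : ∀ m, T (m + 1) = Function.update (T m) m (next m (T m)) := fun _ => rfl
  have hT : ∀ m, Extendable φ es m (T m) := by
    intro m
    induction m with
    | zero =>
      intro N
      obtain ⟨t, ht⟩ := h N
      exact ⟨t, fun i hi => absurd hi (Nat.not_lt_zero i), ht⟩
    | succ m ih => exact hnext m (T m) ih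
  have hstable : ∀ i m, i < m → T m i = T (i + 1) i := by
    intro i m him
    induction m, him using Nat.le_induction with
    | base => rfl
    | succ m hm ih => rw [hTs, Function.update_of_ne (by omega), ih]
  refine ⟨fun i => T (i + 1) i, fun n => ?_⟩
  obtain ⟨t, h1, h2⟩ := hT n n
  exact h2.congr fun i hi => (h1 i hi).trans (hstable i n hi)

/-! ### The maximum set system of a pattern -/

theorem map_range_eq_ofFn {β : Type*} (n : ℕ) (x : ℕ → β) :
    (List.range n).map x = List.ofFn fun i : Fin n => x i := by
  apply List.ext_getElem <;> simp

/-- A word accepted by `es` and placed on a finite set of positions extends to an infinite word all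
of whose prefixes are accepted. -/
theorem exists_extension {es : List Bool} (I : Finset ℕ) (y : ℕ → Bool)
    (hy : ∀ n, Accepts es (((List.range n).filter (· ∈ I)).map y)) :
    ∃ x : ℕ → Bool, (∀ i ∈ I, x i = y i) ∧ ∀ n, Accepts es ((List.range n).map x) := by
  let σ : ℕ → List Bool := fun n => (((List.range n).filter (· ∈ I)).map y).foldl step es
  -- Off `I`, reading the head of the current state leaves that state unchanged. The default `false`
  -- never occurs, as `hy` keeps states nonempty.
  let x : ℕ → Bool := fun i => if i ∈ I then y i else (σ i).headD false
  have hx : ∀ n, ((List.range n).map x).foldl step es = σ n := by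
    intro n
    induction n with
    | zero => rfl
    | succ n ih =>
      rw [List.range_succ, List.map_append, List.foldl_append, ih]
      by_cases hn : n ∈ I
      · simp [σ, x, hn, List.range_succ, List.filter_append]
      · obtain ⟨e, t, ht⟩ := List.exists_cons_of_ne_nil (hy n)
        have h1 : σ (n + 1) = σ n := by simp [σ, hn, List.range_succ, List.filter_append]
        have h2 : σ n = e :: t := ht
        rw [h1]
        simp [x, hn, h2, step]
  refine ⟨x, fun i hi => if_pos hi, fun n => ?_⟩
  unfold Accepts
  rw [hx]
  exact hy n

/-- The subsets of the range of `a` whose characteristic word is accepted. -/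
def acceptedSets {Y : Type*} (es : List Bool) (a : ℕ → Y) : Set (Set Y) :=
  open Classical in
  {P | P ⊆ Set.range a ∧ ∀ n, Accepts es ((List.range n).map fun i => decide (a i ∈ P))}

/-- Traces on `F` correspond to accepted words of length `F.card`: closure under subwords gives one
inclusion, `exists_extension` the other. -/
theorem isMaximumOn_acceptedSets {Y : Type*} {a : ℕ → Y} (ha : Function.Injective a) {d : ℕ}
    {es : List Bool} (hes : es.length = d + 1) :
    IsMaximumOn d (acceptedSets es a) (Set.range a) := by
  classical
  refine ⟨fun P hP => hP.1, fun F hF => ?_⟩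
  let I : Finset ℕ := F.preimage a ha.injOn
  have hI : ∀ i, i ∈ I ↔ a i ∈ F := fun i => Finset.mem_preimage
  obtain ⟨N, hN⟩ : ∃ N, ∀ i ∈ I, i < N :=
    ⟨I.sup id + 1, fun i hi => Nat.lt_succ_of_le (Finset.le_sup (f := id) hi)⟩
  let J : List ℕ := (List.range N).filter (· ∈ I)
  have hJ : ∀ i, i ∈ J ↔ i ∈ I := fun i => by
    simp only [J, List.mem_filter, List.mem_range, decide_eq_true_eq]
    exact ⟨fun h => h.2, fun h => ⟨hN i h, h⟩⟩
  have hJnodup : J.Nodup := List.nodup_range.filter _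
  have hJlen : J.length = F.card := by
    rw [← List.toFinset_card_of_nodup hJnodup]
    refine Finset.card_bij (fun i _ => a i) ?_ (fun i _ j _ h => ha h) ?_
    · intro i hi
      exact (hI i).1 ((hJ i).1 (List.mem_toFinset.1 hi))
    · intro y hy
      obtain ⟨i, rfl⟩ := hF hy
      exact ⟨i, List.mem_toFinset.2 ((hJ i).2 ((hI i).2 hy)), rfl⟩
  let Φ : Set Y → List Bool := fun T => J.map fun i => decide (a i ∈ T)
  have hinj : Set.InjOn Φ (trace (acceptedSets es a) (F : Set Y)) := by
    rintro _ ⟨S, -, rfl⟩ _ ⟨S', -, rfl⟩ h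
    have h' := List.map_inj_left.1 h
    ext y
    simp only [Set.mem_inter_iff, and_congr_left_iff]
    intro hy
    obtain ⟨i, rfl⟩ := hF hy
    have := h' i ((hJ i).2 ((hI i).2 hy))
    simpa [Finset.mem_coe.1 hy] using this
  have himage : Φ '' trace (acceptedSets es a) (F : Set Y) = acceptedWords es F.card := by
    ext w
    constructor
    · rintro ⟨_, ⟨P, hP, rfl⟩, rfl⟩
      refine ⟨by simp [Φ, hJlen], ?_⟩
      have h1 : Φ (P ∩ F) = J.map fun i => decide (a i ∈ P) := by
        refine List.map_congr_left fun i hi => ?_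
        have := (hI i).1 ((hJ i).1 hi)
        simp [this]
      rw [h1]
      exact (hP.2 N).sublist (List.filter_sublist.map _)
    · rintro ⟨hlen, hacc⟩
      let y : ℕ → Bool := fun i => w.getD (J.idxOf i) false
      have hy : J.map y = w := by
        apply List.ext_getElem
        · simp [hJlen, hlen]
        · intro i h1 h2
          have h3 : i < J.length := by simpa using h1
          simp [y, hJnodup.idxOf_getElem i h3, h2]
      obtain ⟨x, hxy, hx⟩ := exists_extension (es := es) I y (by
        intro n
        rcases le_total n N with hn | hn
        · refine (hy.symm ▸ hacc : Accepts es (J.map y)).sublist (List.Sublist.map _ ?_)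
          exact (List.range_sublist.2 hn).filter _
        · have : (List.range n).filter (· ∈ I) = J := by
            induction n, hn using Nat.le_induction with
            | base => rfl
            | succ n hn ih =>
              have : n ∉ I := fun h => (hN n h).not_ge hn
              simp [List.range_succ, List.filter_append, this, ih]
          rw [this, hy]
          exact hacc)
      have hdec : ∀ i, decide (a i ∈ a '' {i | x i = true}) = x i := by
        intro i
        simp [ha.eq_iff]
      refine ⟨_, ⟨a '' {i | x i = true}, ⟨Set.image_subset_range _ _, ?_⟩, rfl⟩, ?_⟩
      · simpa only [hdec] using hx
      · rw [← hy]
        refine List.map_congr_left fun i hi => ?_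
        have hiI := (hJ i).1 hi
        rw [← hxy i hiI, ← hdec i]
        have := (hI i).1 hiI
        simp [this]
  rw [← hinj.ncard_image, himage, ncard_acceptedWords, hes]
  rfl

theorem RealizesAccepted.injective {φ : L.Formula (Fin l ⊕ Fin k)} {es : List Bool}
    (hes : 2 ≤ es.length) {a : ℕ → Fin k → M} (h : ∀ n, RealizesAccepted φ es n a) :
    Function.Injective a := by
  suffices hlt : ∀ i j, i < j → a i ≠ a j by
    intro i j hij
    by_contra hne
    rcases lt_or_gt_of_ne hne with h1 | h1
    · exact hlt i j h1 hij
    · exact hlt j i h1 hij.symm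
  intro i j hij heq
  match es, hes with
  | e :: e' :: es, _ =>
    -- This word is accepted because a second letter of the pattern survives its only deviation; it
    -- separates `a i` from `a j`.
    let x : ℕ → Bool := fun n => if n = j then !e else e
    have hx : (List.range (j + 1)).map x = List.replicate j e ++ [!e] := by
      rw [List.range_succ, List.map_append]
      congr 1
      · rw [List.eq_replicate_iff]
        refine ⟨by simp, fun b hb => ?_⟩
        obtain ⟨n, hn, rfl⟩ := List.mem_map.1 hb
        exact if_neg (List.mem_range.1 hn).ne
      · simp [x]
    have hacc : Accepts (e :: e' :: es) ((List.range (j + 1)).map x) := by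
      rw [hx]
      clear * -
      induction j with
      | zero => simp [Accepts, step]
      | succ j ih => rw [List.replicate_succ, List.cons_append, accepts_cons_self]; exact ih
    rw [map_range_eq_ofFn] at hacc
    obtain ⟨b, hb⟩ := h (j + 1) _ hacc
    have h1 := hb ⟨i, by omega⟩
    have h2 := hb ⟨j, by omega⟩
    simp only [heq] at h1
    rw [h1] at h2
    simp [x, hij.ne] at h2

theorem acceptedSets_subset_phiTypes {φ : L.Formula (Fin l ⊕ Fin k)} {es : List Bool}
    {a : ℕ → Fin k → M} (h : ∀ n, RealizesAccepted φ es n a) :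
    acceptedSets es a ⊆ phiTypes φ (Set.range a) := by
  classical
  rintro P ⟨hP, hacc⟩
  refine ⟨hP, fun F hF => ?_⟩
  have hF' : ∀ y ∈ F, ∃ i, a i = y := fun y hy => hF hy
  choose! ν hν using hF'
  have h1 := hacc (F.sup ν + 1)
  rw [map_range_eq_ofFn] at h1
  obtain ⟨b, hb⟩ := h _ _ h1
  refine ⟨b, fun y hy => ?_⟩
  have := hb ⟨ν y, Nat.lt_succ_of_le (Finset.le_sup hy)⟩
  simpa [hν y hy] using this

theorem coe_ennreal_coe_natCast (n : ℕ) :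
    ((((n : ℕ∞) : ENNReal)) : EReal) = ((n : ℝ) : EReal) := by
  rw [ENat.toENNReal_coe, ← ENNReal.ofReal_natCast, EReal.coe_ennreal_ofReal,
    max_eq_left (Nat.cast_nonneg n)]

theorem succ_le_VCm [Nonempty M] (hM : IsSaturated L M (Cardinal.aleph 1))
    {φ : L.Formula (Fin l ⊕ Fin k)} {d : ℕ} (h : ¬ VCIndDensityLE M φ d) :
    ((d + 1 : ℕ) : ℕ∞) ≤ VCm M φ := by
  obtain ⟨es, hes, hreal⟩ := exists_forall_realizesAccepted h
  obtain ⟨a, ha⟩ := exists_sequence_realizesAccepted hM hreal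
  have hinj := RealizesAccepted.injective (by omega) ha
  exact le_sSup ⟨d + 1, rfl, Set.range a, Set.countable_range a, Set.infinite_range_of_injective hinj,
    acceptedSets es a, acceptedSets_subset_phiTypes ha, isMaximumOn_acceptedSets hinj hes⟩

end

end VCInd

theorem theorem3 {L : FirstOrder.Language.{u, v}} {M : Type w} [L.Structure M] [Nonempty M]
    (hM : VCInd.IsSaturated L M (Cardinal.aleph 1)) {l k : ℕ}
    (φ : L.Formula (Fin l ⊕ Fin k)) :
    ((VCInd.VCm M φ : ENNReal) : EReal) = VCInd.VCdInd M φ := by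
  apply le_antisymm
  · refine le_sInf ?_
    rintro _ ⟨r, rfl, hr⟩
    have h1 : (VCInd.VCm M φ : ENNReal) ≤ ((⌊r⌋₊ : ℕ∞) : ENNReal) :=
      ENat.toENNReal_le.2 (VCInd.VCm_le_of_vcIndDensityLE hM hr)
    have h2 : ((VCInd.VCm M φ : ENNReal) : EReal) ≤ ((⌊r⌋₊ : ℝ) : EReal) := by
      rw [← VCInd.coe_ennreal_coe_natCast]
      exact EReal.coe_ennreal_le_coe_ennreal_iff.2 h1
    exact h2.trans (EReal.coe_le_coe_iff.2 (Nat.floor_le hr.nonneg))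
  · cases hd : VCInd.VCm M φ with
    | top => simp
    | coe d =>
      -- Failure of the exponent `d` would yield a `(d + 1)`-maximum family, so the infimum is
      -- attained at the integer `d`.
      have h : VCInd.VCIndDensityLE M φ d := by
        by_contra h
        have := VCInd.succ_le_VCm hM h
        rw [hd, Nat.cast_le] at this
        omega
      refine le_trans (b := ((d : ℝ) : EReal)) (sInf_le ⟨(d : ℝ), rfl, h⟩) ?_
      rw [← VCInd.coe_ennreal_coe_natCast]
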